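/- Setting (cache-aided multiuser private information retrieval, uncoded prefetching). There are $N\ge 2$ non-colluding databases, each storing $K=2$ independent messages $W_1,W_2$, uniformly distributed over $\{0,1\}^L$, and $K_{\rm u}$ users. Before the demands are known, each user $u$ copies a fixed set of at most $ML$ of the $2L$ library bits into its cache $Z_u$; the placement is known to all databases. For a demand vector $\theta\in[2]^{K_{\rm u}}$ the users jointly generate random queries $Q_1^{[\theta]},\dots,Q_N^{[\theta]}$ (with finite alphabets), which may depend on $\theta$ and on the placement but are independent of the message realizations. Database $n$ broadcasts to all users an answer $A_n^{[\theta]}$ that is a deterministic function of $Q_n^{[\theta]}$ and $W_1,W_2$. A scheme must satisfy decodability, $H(W_{\theta_u}\mid Q_{1:N}^{[\theta]},A_{1:N}^{[\theta]},Z_u)=0$ for every $\theta$ and every user $u$, and privacy, $I(\theta;Q_n^{[\theta]},A_n^{[\theta]},W_{1:2},Z_{1:K_{\rm u}})=0$ for every $n$ and every distribution of $\theta$. Its load is $\sum_{n=1}^N H(A_n^{[\theta]})/L$. A pair $(M,R)$ is achievable if, for some $L\ge1$, there is such a scheme whose load is at most $R$ for every $\theta$. For $t\in\{1,\dots,K_{\rm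 u}-1\}$ let $$M_t=\frac{2\binom{K_{\rm u}-1}{t-1}(N-1)}{\binom{K_{\rm u}}{t}(N-1)+\binom{K_{\rm u}}{t+1}},\qquad R_t=\min\left\{\frac{\binom{K_{\rm u}}{t+1}(N+1)}{\binom{K_{\rm u}}{t}(N-1)+\binom{K_{\rm u}}{t+1}},\;2-M_t\right\},$$ and let $R(M)$, $0\le M\le 2$, be the lower convex envelope of the points $(M_t,R_t)$, $t\in\{1,\dots,K_{\rm u}-1\}$, together with $(0,2)$ and $(2,0)$. Corollary. Let $N\ge 2$ and $K_{\rm u}\in\{2,3\}$. Then $$M_1=\frac{2(N-1)}{K_{\rm u}(N-1)+K_{\rm u}(K_{\rm u}-1)/2},$$ and for every real $M$ with $0\le M\le M_1$ the load $R(M)$ is optimal under uncoded prefetching: $R(M)$ is the infimum of all $R$ such that $(M,R)$ is achievable, and the infimum is attained (that is, $(M,R(M))$ is itself achievable) whenever $M$ is rational, in particular at $M=M_1$. -/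

import Mathlib

noncomputable section

namespace MuPIR

/-! ### Shannon information measures (in bits) for random variables on a finite sample space -/

section Information

variable {Ω α β : Type*} [Fintype α] [Fintype β]

/-- The probability that the random variable `X` takes the value `a`. -/
def prob (p : PMF Ω) (X : Ω → α) (a : α) : ℝ := (p.map X a).toReal

/-- The entropy `H(X)`. -/
def entropy (p : PMF Ω) (X : Ω → α) : ℝ :=
  -∑ a, prob p X a * Real.logb 2 (prob p X a)

/-- The conditional entropy `H(X | Y)`; terms with `P(X = a, Y = b) = 0` contribute `0`. -/
def condEntropy (p : PMF Ω) (X : Ω → α) (Y : Ω → β) : ℝ :=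
  -∑ a, ∑ b, prob p (fun ω => (X ω, Y ω)) (a, b) *
    Real.logb 2 (prob p (fun ω => (X ω, Y ω)) (a, b) / prob p Y b)

/-- The mutual information `I(X ; Y)`; terms with `P(X = a, Y = b) = 0` contribute `0`. -/
def mutualInfo (p : PMF Ω) (X : Ω → α) (Y : Ω → β) : ℝ :=
  ∑ a, ∑ b, prob p (fun ω => (X ω, Y ω)) (a, b) *
    Real.logb 2 (prob p (fun ω => (X ω, Y ω)) (a, b) / (prob p X a * prob p Y b))

end Information

/-! ### The cache-aided multiuser private information retrieval problem -/

/-- A library of `K` messages of `L` bits each. -/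
abbrev Library (K L : ℕ) : Type := Fin K → Fin L → Bool

/-- A demand vector: user `u` wants message `θ u`. -/
abbrev Demand (K Ku : ℕ) : Type := Fin Ku → Fin K

/-- A scheme with uncoded prefetching for `K` messages of `L` bits, `Ku` users and `N` databases.
The placement is chosen before the demands are known. The users generate the queries jointly at
random, from the demand vector and the placement (both are at hand when `queryLaw` is chosen), and
without knowledge of the realization of the messages. -/
structure Scheme (K Ku N L : ℕ) where
  /-- The positions of the library bits that user `u` copies into its cache. -/
  cached : Fin Ku → Finset (Fin K × Fin L)
  /-- The alphabet of the query to database `n`. -/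
  Query : Fin N → Type
  /-- The alphabet of the answer of database `n`. -/
  Answer : Fin N → Type
  [fintypeQuery : ∀ n, Fintype (Query n)]
  [fintypeAnswer : ∀ n, Fintype (Answer n)]
  /-- The joint law of the `N` queries for a given demand vector. -/
  queryLaw : Demand K Ku → PMF (∀ n, Query n)
  /-- The answer of database `n`, a function of its own query and of the messages. -/
  answer : ∀ n, Query n → Library K L → Answer n

attribute [instance] Scheme.fintypeQuery Scheme.fintypeAnswer

namespace Scheme

variable {K Ku N L : ℕ} (s : Scheme K Ku N L)

/-- The outcomes for a fixed demand vector: all queries, and all messages. -/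
abbrev Outcome : Type := (∀ n, s.Query n) × Library K L

/-- The law of queries and messages for a fixed demand vector: the messages are independent and
uniform, and independent of the queries. -/
def law (θ : Demand K Ku) : PMF s.Outcome :=
  (s.queryLaw θ).bind fun q => (PMF.uniformOfFintype (Library K L)).map fun w => (q, w)

/-- The joint law of demands, queries and messages, when the demand vector has law `π`. -/
def jointLaw (π : PMF (Demand K Ku)) : PMF (Demand K Ku × s.Outcome) :=
  π.bind fun θ => (s.law θ).map fun ω => (θ, ω)

/-- The type of the cache content of user `u`. -/
abbrev CacheContent (u : Fin Ku) : Type := {x // x ∈ s.cached u} → Bool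

/-- The cache content of user `u`. -/
def cache (u : Fin Ku) (ω : s.Outcome) : s.CacheContent u :=
  fun x => ω.2 x.1.1 x.1.2

/-- The answer of database `n`. -/
def ans (n : Fin N) (ω : s.Outcome) : s.Answer n :=
  s.answer n (ω.1 n) ω.2

/-- Every user can recover its message from all queries, all answers and its own cache:
`H(W_{θ_u} | Q_{1:N}, A_{1:N}, Z_u) = 0`. -/
def Decodable : Prop :=
  ∀ (θ : Demand K Ku) (u : Fin Ku),
    condEntropy (s.law θ) (fun ω => ω.2 (θ u))
      (fun ω => (ω.1, (fun n => s.ans n ω), s.cache u ω)) = 0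

/-- No single database learns anything about the demands, whatever their law:
`I(θ ; Q_n, A_n, W_{1:K}, Z_{1:K_u}) = 0`. -/
def Private : Prop :=
  ∀ (π : PMF (Demand K Ku)) (n : Fin N),
    mutualInfo (s.jointLaw π) (fun x => x.1)
      (fun x => (x.2.1 n, s.ans n x.2, x.2.2, fun u => s.cache u x.2)) = 0

/-- The load `∑ₙ H(A_n) / L` for the demand vector `θ`. -/
def load (θ : Demand K Ku) : ℝ :=
  (∑ n, entropy (s.law θ) (s.ans n)) / L

end Scheme

/-- The memory-load pair `(M, R)` is achievable with uncoded prefetching: for some message length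
there is a decodable and private scheme in which every user caches at most `M * L` bits and whose
load is at most `R`. -/
def Achievable (K Ku N : ℕ) (M R : ℝ) : Prop :=
  ∃ (L : ℕ) (s : Scheme K Ku N L), 0 < L ∧
    (∀ u, ((s.cached u).card : ℝ) ≤ M * L) ∧ s.Decodable ∧ s.Private ∧ ∀ θ, s.load θ ≤ R

/-! ### The load of the two-message scheme -/

/-- The memory `M_t`. -/
def memPt (Ku N t : ℕ) : ℝ :=
  2 * ((Ku - 1).choose (t - 1) : ℝ) * ((N : ℝ) - 1) /
    ((Ku.choose t : ℝ) * ((N : ℝ) - 1) + (Ku.choose (t + 1) : ℝ))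

/-- The load `R_t`. -/
def loadPt (Ku N t : ℕ) : ℝ :=
  min ((Ku.choose (t + 1) : ℝ) * ((N : ℝ) + 1) /
      ((Ku.choose t : ℝ) * ((N : ℝ) - 1) + (Ku.choose (t + 1) : ℝ)))
    (2 - memPt Ku N t)

/-- The pairs `(M_t, R_t)` for `1 ≤ t ≤ Ku - 1`, together with `(0, 2)` and `(2, 0)`. -/
def cornerPts (Ku N : ℕ) : Set (ℝ × ℝ) :=
  {(0, 2), (2, 0)} ∪ {x | ∃ t : ℕ, 1 ≤ t ∧ t + 1 ≤ Ku ∧ x = (memPt Ku N t, loadPt Ku N t)}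

/-- The lower convex envelope of a set of points of the plane. -/
def lowerConvexEnvelope (S : Set (ℝ × ℝ)) (x : ℝ) : ℝ :=
  sInf {y | (x, y) ∈ convexHull ℝ S}

/-- The load of the two-message scheme at memory `M`. -/
def schemeLoad (Ku N : ℕ) (M : ℝ) : ℝ := lowerConvexEnvelope (cornerPts Ku N) M

end MuPIR

end

/-!
For two and three users the envelope `R(M)` on `[0, M₁]` is the line `2 - 3M/2`, so there are two
things to prove about this line.

*Converse.* No pair below the line is achievable, even without privacy (`Achievable.le`). Let user
`u` want one message and user `v` the other one. For fixed queries, all answers together with the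
bits that `u` caches of its own message and that `u` or `v` caches of the other message determine
the library: decode first for `u`, then for `v`. By Gibbs' inequality, applied to the product of
the marginal laws of the answers, the answers then have total entropy at least the number of the
remaining library bits (`Scheme.le_sum_entropy`). Adding the bounds for a demand vector and for the
one with the messages exchanged gives `2RL ≥ 4L - |Z_u| - |Z_u ∪ Z_v| ≥ 4L - 3ML`.

*Achievability.* For `m + 1` databases, `twoMessageScheme` splits each message into a part of `m`
symbols for each user, cached by that user, and one uncached symbol for each pair of users. For
each pair `{u, v}` and each message there is a combination: the uncached symbol of the pair, plus
one symbol from the part of `u` and one from the part of `v`, either of which may be a dummy zero.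
The indices are uniformly random, and the index that serves `v` is shifted by the number of the
database if `v` wants the message. Thus each database sees a uniform query, whence privacy.
Database `0` sends the combinations of the two messages separately, the others send their sum. A
user knows its own part of the unwanted message, so for the pairs it belongs to the combination of
that message, learned from database `0`, is known at every database and can be cancelled; the
combination of the wanted message then runs over all symbols of the other user's part and the dummy
symbol, which gives the part and the uncached symbol. Knowing all parts, the user reads the other
uncached symbols off the answer of database `0`. Symbols of several bits, together with bits that
database `0` sends in the clear, realize every rational memory in `[0, M₁]` exactly
(`achievable_of_rat`); other memories are approximated from below.
-/

noncomputable section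

namespace MuPIR

/-! ### Entropy and mutual information as expectations -/

section Information

open scoped Classical in
theorem prob_eq_sum {Ω α : Type*} [Fintype Ω] (p : PMF Ω) (X : Ω → α) (a : α) :
    prob p X a = ∑ ω, if X ω = a then (p ω).toReal else 0 := by
  rw [prob, PMF.map_apply, tsum_fintype, ENNReal.toReal_sum]
  · refine Finset.sum_congr rfl fun ω _ => ?_
    by_cases h : X ω = a
    · simp [h]
    · simp [h, Ne.symm h]
  · intro ω _
    split_ifs
    · exact p.apply_ne_top ω
    · simp

theorem sum_toReal_apply {Ω : Type*} [Fintype Ω] (p : PMF Ω) : ∑ ω, (p ω).toReal = 1 := by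
  rw [← ENNReal.toReal_sum fun ω _ => p.apply_ne_top ω,
    ← tsum_fintype (L := .unconditional _), p.tsum_coe, ENNReal.toReal_one]

theorem prob_nonneg {Ω α : Type*} (p : PMF Ω) (X : Ω → α) (a : α) : 0 ≤ prob p X a :=
  ENNReal.toReal_nonneg

variable {Ω α β : Type*} [Fintype Ω] [Fintype α] [Fintype β]

/-- Change of variables: the expectation of `f(X)` computed on the alphabet and on the sample
space. -/
theorem sum_prob_mul (p : PMF Ω) (X : Ω → α) (f : α → ℝ) :
    ∑ a, prob p X a * f a = ∑ ω, (p ω).toReal * f (X ω) := by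
  classical
  simp only [prob_eq_sum, Finset.sum_mul, ite_mul, zero_mul]
  rw [Finset.sum_comm]
  simp

theorem sum_prob (p : PMF Ω) (X : Ω → α) : ∑ a, prob p X a = 1 := by
  simpa [sum_toReal_apply] using sum_prob_mul p X fun _ => 1

theorem prob_apply_pos {Ω α : Type*} [Fintype Ω] (p : PMF Ω) (X : Ω → α) {ω : Ω}
    (h : p ω ≠ 0) : 0 < prob p X (X ω) := by
  classical
  rw [prob_eq_sum]
  refine lt_of_lt_of_le (ENNReal.toReal_pos h (p.apply_ne_top ω)) ?_
  refine le_trans (by simp) (Finset.single_le_sum (f := fun ω' =>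
    if X ω' = X ω then (p ω').toReal else 0) (fun i _ => ?_) (Finset.mem_univ ω))
  split_ifs <;> simp

theorem entropy_eq_sum (p : PMF Ω) (X : Ω → α) :
    entropy p X = -∑ ω, (p ω).toReal * Real.logb 2 (prob p X (X ω)) := by
  rw [entropy, sum_prob_mul p X fun a => Real.logb 2 (prob p X a)]

/-- Gibbs' inequality: if `g` is positive on the support and has expectation at most one, then
`log g` has expectation at most zero. -/
theorem sum_mul_logb_nonpos (p : PMF Ω) (g : Ω → ℝ) (hg : ∀ ω, p ω ≠ 0 → 0 < g ω)
    (h : ∑ ω, (p ω).toReal * g ω ≤ 1) : ∑ ω, (p ω).toReal * Real.logb 2 (g ω) ≤ 0 := by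
  have key : ∑ ω, (p ω).toReal * Real.log (g ω) ≤ 0 := by
    calc ∑ ω, (p ω).toReal * Real.log (g ω)
        ≤ ∑ ω, ((p ω).toReal * g ω - (p ω).toReal) := by
          refine Finset.sum_le_sum fun ω _ => ?_
          by_cases hω : p ω = 0
          · simp [hω]
          · have := Real.log_le_sub_one_of_pos (hg ω hω)
            nlinarith [ENNReal.toReal_nonneg (a := p ω)]
      _ ≤ 0 := by rw [Finset.sum_sub_distrib, sum_toReal_apply]; linarith
  simp only [Real.logb, ← mul_div_assoc, ← Finset.sum_div]
  exact div_nonpos_of_nonpos_of_nonneg key (Real.log_nonneg (by norm_num))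

theorem entropy_le_logb_card (p : PMF Ω) (X : Ω → α) :
    entropy p X ≤ Real.logb 2 (Fintype.card α) := by
  obtain ⟨ω₀, -⟩ := p.support_nonempty
  have : Nonempty α := ⟨X ω₀⟩
  have hc : (0 : ℝ) < Fintype.card α := by exact_mod_cast Fintype.card_pos
  have hsum : ∑ ω, (p ω).toReal * (prob p X (X ω) * Fintype.card α)⁻¹ ≤ 1 := by
    rw [← sum_prob_mul p X fun a => (prob p X a * Fintype.card α)⁻¹]
    calc ∑ a, prob p X a * (prob p X a * Fintype.card α)⁻¹
        ≤ ∑ _a : α, (Fintype.card α : ℝ)⁻¹ := by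
          refine Finset.sum_le_sum fun a _ => ?_
          by_cases h : prob p X a = 0
          · simp [h]
          · rw [mul_inv, mul_inv_cancel_left₀ h]
      _ = 1 := by simp [hc.ne']
  have := sum_mul_logb_nonpos p _
    (fun ω hω => inv_pos.2 (mul_pos (prob_apply_pos p X hω) hc)) hsum
  rw [entropy_eq_sum]
  have e : ∑ ω, (p ω).toReal * Real.logb 2 (prob p X (X ω) * Fintype.card α)⁻¹
      = ∑ ω, (-((p ω).toReal * Real.logb 2 (prob p X (X ω))) -
          (p ω).toReal * Real.logb 2 (Fintype.card α)) := by
    refine Finset.sum_congr rfl fun ω _ => ?_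
    by_cases hω : p ω = 0
    · simp [hω]
    · rw [Real.logb_inv, Real.logb_mul (prob_apply_pos p X hω).ne' hc.ne']
      ring
  rw [e, Finset.sum_sub_distrib, ← Finset.sum_mul, sum_toReal_apply,
    Finset.sum_neg_distrib] at this
  linarith

open scoped Classical in
theorem prob_sub_prob_prod {Ω α β : Type*} [Fintype Ω] (p : PMF Ω) (X : Ω → α) (Y : Ω → β)
    (a : α) (b : β) : prob p Y b - prob p (fun ω => (X ω, Y ω)) (a, b) =
      ∑ ω, if Y ω = b ∧ X ω ≠ a then (p ω).toReal else 0 := by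
  rw [prob_eq_sum, prob_eq_sum, ← Finset.sum_sub_distrib]
  refine Finset.sum_congr rfl fun ω _ => ?_
  by_cases h1 : Y ω = b <;> by_cases h2 : X ω = a <;> simp [h1, h2]

/-- Vanishing conditional entropy means that on the support `X` is a function of `Y`. -/
theorem condEntropy_eq_zero_iff (p : PMF Ω) (X : Ω → α) (Y : Ω → β) :
    condEntropy p X Y = 0 ↔
      ∀ ω ω', p ω ≠ 0 → p ω' ≠ 0 → Y ω = Y ω' → X ω = X ω' := by
  classical
  have hsum : condEntropy p X Y = ∑ ω, (p ω).toReal *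
      -Real.logb 2 (prob p (fun ω => (X ω, Y ω)) (X ω, Y ω) / prob p Y (Y ω)) := by
    simp only [condEntropy, mul_neg, Finset.sum_neg_distrib]
    rw [← Fintype.sum_prod_type' (fun a b => prob p (fun ω => (X ω, Y ω)) (a, b) *
      Real.logb 2 (prob p (fun ω => (X ω, Y ω)) (a, b) / prob p Y b)),
      sum_prob_mul p (fun ω => (X ω, Y ω)) fun c =>
        Real.logb 2 (prob p (fun ω => (X ω, Y ω)) (c.1, c.2) / prob p Y c.2)]
  have hle : ∀ a b, prob p (fun ω => (X ω, Y ω)) (a, b) ≤ prob p Y b := fun a b => by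
    rw [← sub_nonneg, prob_sub_prob_prod]
    exact Finset.sum_nonneg fun ω _ => by split_ifs <;> simp
  have hpos : ∀ ω, p ω ≠ 0 → 0 < prob p (fun ω => (X ω, Y ω)) (X ω, Y ω) / prob p Y (Y ω) :=
    fun ω h => div_pos (prob_apply_pos p (fun ω => (X ω, Y ω)) h) (prob_apply_pos p Y h)
  have hnn : ∀ ω, 0 ≤ (p ω).toReal *
      -Real.logb 2 (prob p (fun ω => (X ω, Y ω)) (X ω, Y ω) / prob p Y (Y ω)) := fun ω => by
    refine mul_nonneg ENNReal.toReal_nonneg (neg_nonneg.2 ?_)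
    exact Real.logb_nonpos (by norm_num) (div_nonneg (prob_nonneg ..) (prob_nonneg ..))
      (div_le_one_of_le₀ (hle _ _) (prob_nonneg ..))
  rw [hsum, Finset.sum_eq_zero_iff_of_nonneg fun ω _ => hnn ω]
  have hterm : ∀ ω, p ω ≠ 0 → ((p ω).toReal *
      -Real.logb 2 (prob p (fun ω => (X ω, Y ω)) (X ω, Y ω) / prob p Y (Y ω)) = 0 ↔
      ∀ ω', p ω' ≠ 0 → Y ω' = Y ω → X ω' = X ω) := fun ω h => by
    have h0 : (p ω).toReal ≠ 0 := (ENNReal.toReal_pos h (p.apply_ne_top ω)).ne'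
    have hY := prob_apply_pos p Y h
    have hone : Real.logb 2 (prob p (fun ω => (X ω, Y ω)) (X ω, Y ω) / prob p Y (Y ω)) = 0 ↔
        prob p Y (Y ω) - prob p (fun ω => (X ω, Y ω)) (X ω, Y ω) = 0 := by
      rw [sub_eq_zero, eq_comm (a := prob p Y (Y ω)), ← div_eq_one_iff_eq hY.ne']
      constructor
      · intro hl
        have := hpos ω h
        rcases Real.logb_eq_zero.1 hl with h | h | h | h | h | h <;> linarith
      · intro h; simp [h]
    rw [mul_eq_zero, or_iff_right h0, neg_eq_zero, hone, prob_sub_prob_prod,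
      Finset.sum_eq_zero_iff_of_nonneg fun ω _ => by split_ifs <;> simp]
    constructor
    · intro H ω' h' hYY
      by_contra hX
      have := H ω' (Finset.mem_univ _)
      rw [if_pos ⟨hYY, hX⟩] at this
      exact (ENNReal.toReal_pos h' (p.apply_ne_top ω')).ne' this
    · intro H ω' _
      split_ifs with hc
      · by_contra hne
        exact hc.2 (H ω' (fun h => hne (by simp [h])) hc.1)
      · rfl
  constructor
  · intro H ω ω' h h' hYY
    exact ((hterm ω h).1 (H ω (Finset.mem_univ _)) ω' h' hYY.symm).symm
  · intro H ω _
    by_cases h : p ω = 0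
    · simp [h]
    · exact (hterm ω h).2 fun ω' h' hYY => H ω' ω h' h hYY

end Information

section Independence

variable {Ω α β : Type*} [Fintype α] [Fintype β]

theorem prob_bind_map_prodMk (π : PMF α) (ρ : PMF β) (a : α) (b : β) :
    (π.bind fun a => ρ.map (Prod.mk a)) (a, b) = π a * ρ b := by
  classical
  rw [PMF.bind_apply, tsum_fintype, Finset.sum_eq_single a]
  · rw [PMF.map_apply, tsum_fintype]
    simp
  · intro a' _ h
    rw [PMF.map_apply, tsum_fintype]
    simp [Ne.symm h]
  · simp

theorem mutualInfo_eq_zero_of_map_eq (p : PMF Ω) (X : Ω → α) (Y : Ω → β) (π : PMF α) (ρ : PMF β)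
    (h : p.map (fun ω => (X ω, Y ω)) = π.bind fun a => ρ.map (Prod.mk a)) :
    mutualInfo p X Y = 0 := by
  classical
  have hX : p.map X = π := by
    have := congrArg (PMF.map Prod.fst) h
    rw [PMF.map_comp, PMF.map_bind] at this
    simpa [PMF.map_comp, Function.comp_def, PMF.map, PMF.bind_const] using this
  have hY : p.map Y = ρ := by
    have := congrArg (PMF.map Prod.snd) h
    rw [PMF.map_comp, PMF.map_bind] at this
    simpa [PMF.map_comp, Function.comp_def, PMF.map, PMF.bind_const] using this
  refine Finset.sum_eq_zero fun a _ => Finset.sum_eq_zero fun b _ => ?_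
  have hXY : prob p (fun ω => (X ω, Y ω)) (a, b) = prob p X a * prob p Y b := by
    simp only [prob, h, hX, hY, prob_bind_map_prodMk, ENNReal.toReal_mul]
  rw [hXY]
  by_cases h0 : prob p X a * prob p Y b = 0
  · simp [h0]
  · simp [div_self h0]

end Independence

/-! ### The converse bound -/

theorem sum_comp_le_of_injective {ι κ : Type*} [Fintype ι] [Fintype κ] (φ : ι → κ)
    (hφ : Function.Injective φ) (F : κ → ℝ) (hF : ∀ x, 0 ≤ F x) : ∑ i, F (φ i) ≤ ∑ x, F x := by
  classical
  rw [← Finset.sum_image (f := F) (g := φ) (s := Finset.univ) fun x _ y _ h => hφ h]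
  exact Finset.sum_le_sum_of_subset_of_nonneg (Finset.subset_univ _) fun x _ _ => hF x

namespace Scheme

variable {K Ku N L : ℕ} (s : Scheme K Ku N L)

theorem law_apply (θ : Demand K Ku) (q : ∀ n, s.Query n) (w : Library K L) :
    s.law θ (q, w) = s.queryLaw θ q * (Fintype.card (Library K L) : ENNReal)⁻¹ := by
  classical
  have h : s.law θ = (s.queryLaw θ).bind fun q =>
      (PMF.uniformOfFintype (Library K L)).map (Prod.mk q) := rfl
  rw [h, prob_bind_map_prodMk, PMF.uniformOfFintype_apply]

theorem law_apply_ne_zero (θ : Demand K Ku) (q : ∀ n, s.Query n) (w : Library K L) :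
    s.law θ (q, w) ≠ 0 ↔ s.queryLaw θ q ≠ 0 := by
  rw [law_apply]
  simp

theorem decodable_iff : s.Decodable ↔ ∀ (θ : Demand K Ku) (u : Fin Ku) (q : ∀ n, s.Query n),
    s.queryLaw θ q ≠ 0 → ∀ w w' : Library K L,
      (∀ n, s.answer n (q n) w = s.answer n (q n) w') →
      (∀ x ∈ s.cached u, w x.1 x.2 = w' x.1 x.2) → w (θ u) = w' (θ u) := by
  simp only [Decodable, condEntropy_eq_zero_iff]
  refine forall₂_congr fun θ u => ?_
  constructor
  · intro H q hq w w' hA hZ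
    refine H (q, w) (q, w') ((law_apply_ne_zero ..).2 hq) ((law_apply_ne_zero ..).2 hq) ?_
    simp only [Prod.mk.injEq, true_and]
    exact ⟨funext hA, funext fun x => hZ x.1 x.2⟩
  · rintro H ⟨q, w⟩ ⟨q', w'⟩ h h' hY
    simp only [Prod.mk.injEq] at hY
    obtain ⟨rfl, hA, hZ⟩ := hY
    exact H q ((law_apply_ne_zero ..).1 h) w w' (congrFun hA) fun x hx => congrFun hZ ⟨x, hx⟩

/-- If, for all queries that occur, the answers together with the library bits at the positions
`C` determine the library, then the answers carry at least as many bits as there are positions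
outside `C`. -/
theorem le_sum_entropy (θ : Demand K Ku) (C : Finset (Fin K × Fin L))
    (hC : ∀ q, s.queryLaw θ q ≠ 0 → ∀ w w' : Library K L,
      (∀ n, s.answer n (q n) w = s.answer n (q n) w') →
      (∀ x ∈ C, w x.1 x.2 = w' x.1 x.2) → w = w') :
    (K * L : ℝ) - C.card ≤ ∑ n, entropy (s.law θ) (s.ans n) := by
  classical
  set p := s.law θ with hp
  -- the product of the marginal laws of the answers, the comparison law in Gibbs' inequality
  let g : (∀ n, s.Answer n) → ℝ := fun a => ∏ n, prob p (s.ans n) (a n)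
  have hg0 : ∀ a, 0 ≤ g a := fun a => Finset.prod_nonneg fun n _ => prob_nonneg ..
  have hgsum : ∑ a, g a = 1 := by
    rw [← Fintype.prod_sum fun n a => prob p (s.ans n) a]
    simp [sum_prob]
  have hcard : (Fintype.card (Library K L) : ℝ) = 2 ^ (K * L) := by
    simp [← pow_mul, mul_comm]
  have hinner : ∀ q, s.queryLaw θ q ≠ 0 →
      ∑ w : Library K L, g (fun n => s.answer n (q n) w) ≤ 2 ^ C.card := by
    intro q hq
    let φ : Library K L → (∀ n, s.Answer n) × ({x // x ∈ C} → Bool) :=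
      fun w => (fun n => s.answer n (q n) w, fun x => w x.1.1 x.1.2)
    have hφ : Function.Injective φ := fun w w' h => by
      simp only [φ, Prod.mk.injEq] at h
      exact hC q hq w w' (congrFun h.1) fun x hx => congrFun h.2 ⟨x, hx⟩
    refine (sum_comp_le_of_injective φ hφ (fun x => g x.1) fun x => hg0 _).trans_eq ?_
    rw [Fintype.sum_prod_type]
    simp [← Finset.mul_sum, hgsum]
  have hE : ∑ ω, (p ω).toReal *
      (g (fun n => s.ans n ω) * (2 ^ (K * L) * (2 ^ C.card)⁻¹)) ≤ 1 := by
    rw [Fintype.sum_prod_type]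
    calc _ ≤ ∑ q, (s.queryLaw θ q).toReal := by
          refine Finset.sum_le_sum fun q _ => ?_
          by_cases hq : s.queryLaw θ q = 0
          · simp [hp, law_apply, hq]
          · have h2 : (0 : ℝ) < 2 ^ (K * L) := by positivity
            have h3 : (0 : ℝ) < 2 ^ C.card := by positivity
            calc _ = (s.queryLaw θ q).toReal * ((2 ^ C.card)⁻¹ *
                  ∑ w : Library K L, g (fun n => s.answer n (q n) w)) := by
                  rw [Finset.mul_sum, Finset.mul_sum]
                  refine Finset.sum_congr rfl fun w _ => ?_
                  rw [hp, law_apply, ENNReal.toReal_mul, ENNReal.toReal_inv,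
                    ENNReal.toReal_natCast, hcard]
                  simp only [Scheme.ans]
                  field_simp
              _ ≤ (s.queryLaw θ q).toReal * 1 := by
                  refine mul_le_mul_of_nonneg_left ?_ ENNReal.toReal_nonneg
                  rw [inv_mul_le_iff₀ h3, mul_one]
                  exact hinner q hq
              _ = _ := mul_one _
      _ = 1 := sum_toReal_apply _
  have hgpos : ∀ ω, p ω ≠ 0 → 0 < g (fun n => s.ans n ω) := fun ω h =>
    Finset.prod_pos fun n _ => prob_apply_pos p (s.ans n) h
  have key := sum_mul_logb_nonpos p _ (fun ω h => mul_pos (hgpos ω h) (by positivity)) hE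
  have e : ∀ ω, (p ω).toReal * Real.logb 2
      (g (fun n => s.ans n ω) * (2 ^ (K * L) * (2 ^ C.card)⁻¹)) =
      ∑ n, (p ω).toReal * Real.logb 2 (prob p (s.ans n) (s.ans n ω)) +
        (p ω).toReal * (K * L - C.card) := fun ω => by
    by_cases h : p ω = 0
    · simp [h]
    · have hl : ∀ k : ℕ, Real.logb 2 (2 ^ k) = k := fun k => by
        rw [Real.logb_pow, Real.logb_self_eq_one (by norm_num), mul_one]
      rw [Real.logb_mul (hgpos ω h).ne' (by positivity), Real.logb_mul (by positivity)
        (by positivity), Real.logb_inv, hl, hl,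
        Real.logb_prod _ _ fun n _ => (prob_apply_pos p (s.ans n) h).ne', mul_add, Finset.mul_sum]
      push_cast
      ring
  simp only [e] at key
  rw [Finset.sum_add_distrib, ← Finset.sum_mul, sum_toReal_apply, Finset.sum_comm] at key
  simp only [entropy_eq_sum, Finset.sum_neg_distrib]
  linarith

end Scheme

/-- The cut-set step: if users `u` and `v` want different messages, then the answers and the bits
that `u` holds of its own message and that `u` or `v` holds of the other one determine the whole
library, by decoding first for `u` and then for `v`. -/
theorem Scheme.Decodable.le_sum_entropy {Ku N L : ℕ} {s : Scheme 2 Ku N L} (hs : s.Decodable)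
    (θ : Demand 2 Ku) {u v : Fin Ku} (huv : θ u ≠ θ v) :
    (2 * L : ℝ) - (((s.cached u).filter fun x => x.1 = θ u).card +
      ((s.cached u ∪ s.cached v).filter fun x => x.1 = θ v).card) ≤
      ∑ n, entropy (s.law θ) (s.ans n) := by
  have hk : ∀ k : Fin 2, k = θ u ∨ k = θ v := fun k => by omega
  have h := s.le_sum_entropy θ (((s.cached u).filter fun x => x.1 = θ u) ∪
    ((s.cached u ∪ s.cached v).filter fun x => x.1 = θ v)) fun q hq w w' hA hC => by
      simp only [Finset.mem_union, Finset.mem_filter] at hC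
      have hu : w (θ u) = w' (θ u) := Scheme.decodable_iff _ |>.1 hs θ u q hq w w' hA
        fun x hx => hC x <| (hk x.1).imp (fun h => ⟨hx, h⟩) fun h => ⟨Or.inl hx, h⟩
      have hv : w (θ v) = w' (θ v) := Scheme.decodable_iff _ |>.1 hs θ v q hq w w' hA fun x hx => by
        rcases hk x.1 with h | h
        · rw [h, hu]
        · exact hC x (Or.inr ⟨Or.inr hx, h⟩)
      funext k
      rcases hk k with rfl | rfl
      exacts [hu, hv]
  refine le_trans ?_ h
  have := Finset.card_union_le ((s.cached u).filter fun x => x.1 = θ u)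
    ((s.cached u ∪ s.cached v).filter fun x => x.1 = θ v)
  have : (((((s.cached u).filter fun x => x.1 = θ u) ∪
    ((s.cached u ∪ s.cached v).filter fun x => x.1 = θ v)).card : ℕ) : ℝ) ≤ _ :=
      Nat.cast_le.2 this
  push_cast at this ⊢
  linarith

/-- The converse: averaging the cut-set bound over a demand vector and the one with the two
messages exchanged. -/
theorem Achievable.le {Ku N : ℕ} (hKu : 2 ≤ Ku) {M R : ℝ} (h : Achievable 2 Ku N M R) :
    2 - 3 / 2 * M ≤ R := by
  obtain ⟨L, s, hL, hM, hdec, -, hR⟩ := h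
  have hL' : (0 : ℝ) < L := by exact_mod_cast hL
  let u : Fin Ku := ⟨0, by omega⟩
  let v : Fin Ku := ⟨1, by omega⟩
  have hvu : v ≠ u := by simp [u, v, Fin.ext_iff]
  let θ : Demand 2 Ku := fun x => if x = u then 0 else 1
  let θ' : Demand 2 Ku := fun x => if x = u then 1 else 0
  have h1 := hdec.le_sum_entropy θ (u := u) (v := v) (by simp [θ, hvu])
  have h2 := hdec.le_sum_entropy θ' (u := u) (v := v) (by simp [θ', hvu])
  have r1 := hR θ
  have r2 := hR θ'
  rw [Scheme.load, div_le_iff₀ hL'] at r1 r2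
  have mu := hM u
  have mv := hM v
  simp only [θ, θ', if_true, if_neg hvu] at h1 h2
  have split : ∀ S : Finset (Fin 2 × Fin L), (S.filter fun x => x.1 = 0).card +
      (S.filter fun x => x.1 = 1).card = S.card := fun S => by
    rw [← Finset.card_filter_add_card_filter_not (s := S) fun x => x.1 = 0]
    congr 2
    ext x
    simp only [Finset.mem_filter]
    constructor <;> rintro ⟨h, h'⟩ <;> exact ⟨h, by omega⟩
  have su : (_ : ℝ) = _ := congrArg Nat.cast (split (s.cached u))
  have suv : (_ : ℝ) = _ := congrArg Nat.cast (split (s.cached u ∪ s.cached v))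
  have un : (_ : ℝ) ≤ _ := Nat.cast_le.2 (Finset.card_union_le (s.cached u) (s.cached v))
  push_cast at su suv un
  have : (2 - 3 / 2 * M) * L ≤ R * L := by simp only [θ, θ'] at r1 r2; linarith
  exact le_of_mul_le_mul_right this hL'

/-! ### Privacy and load of a scheme -/

namespace Scheme

variable {K Ku N L : ℕ} (s : Scheme K Ku N L)

/-- A scheme is private as soon as the law of each single query does not depend on the demands:
answers and cache contents are functions of the query and the messages. -/
theorem private_of_map_queryLaw (ν : ∀ n, PMF (s.Query n))
    (h : ∀ θ n, (s.queryLaw θ).map (fun q => q n) = ν n) : s.Private := by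
  intro π n
  let f : s.Query n → Library K L →
      s.Query n × s.Answer n × Library K L × (∀ u, s.CacheContent u) :=
    fun q w => (q, s.answer n q w, w, fun u x => w x.1.1 x.1.2)
  refine mutualInfo_eq_zero_of_map_eq _ _ _ π
    ((ν n).bind fun q => (PMF.uniformOfFintype (Library K L)).map (f q)) ?_
  rw [jointLaw, PMF.map_bind]
  congr 1
  funext θ
  rw [← h θ n, law, PMF.bind_map, PMF.map_bind, PMF.map_bind, PMF.map_bind]
  congr 1
  funext q
  simp only [Function.comp_apply, PMF.map_comp]
  rfl

theorem sum_entropy_ans_le (θ : Demand K Ku) :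
    ∑ n, entropy (s.law θ) (s.ans n) ≤ ∑ n, Real.logb 2 (Fintype.card (s.Answer n)) :=
  Finset.sum_le_sum fun _ _ => entropy_le_logb_card _ _

end Scheme

theorem map_uniformOfFintype_of_bijective {α : Type*} [Fintype α] [Nonempty α] {f : α → α}
    (hf : Function.Bijective f) :
    (PMF.uniformOfFintype α).map f = PMF.uniformOfFintype α := by
  classical
  ext b
  obtain ⟨a, rfl⟩ := hf.surjective b
  rw [PMF.map_apply, tsum_fintype, Finset.sum_eq_single a]
  · simp
  · intro a' _ h
    rw [if_neg fun h' => h (hf.injective h').symm]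
  · simp

/-! ### The two-message scheme -/

/-- The pairs of distinct users, each listed once. -/
abbrev UserPair (Ku : ℕ) : Type := {x : Fin Ku × Fin Ku // x.1 < x.2}

/-- The bits of one message: for each user `m` symbols of `c` bits that this user caches, for each
pair of users one uncached symbol of `c` bits, and `b` uncached bits that are sent in the clear. -/
abbrev BitPos (Ku m c b : ℕ) : Type :=
  (Fin Ku × Fin m × Fin c) ⊕ (UserPair Ku × Fin c) ⊕ Fin b

/-- The bits broadcast by database `n`: for each pair of users one symbol, two if `n = 0` (one per
message), and from database `0` also the bits of both messages that are sent in the clear. -/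
abbrev AnswerPos (Ku m c b : ℕ) (n : Fin (m + 1)) : Type :=
  (UserPair Ku × Fin c × {k : Fin 2 // n = 0 ∨ k = 0}) ⊕ {_x : Fin 2 × Fin b // n = 0}

section TwoMessageScheme

variable {Ku m c b L : ℕ} (e : BitPos Ku m c b ≃ Fin L)

/-- Bit `j` of the symbol with index `i` in the part of message `k` cached by user `u`; index `0`
is a dummy symbol, equal to zero. -/
def cachedSymbol (w : Library 2 L) (k : Fin 2) (u : Fin Ku) (i : Fin (m + 1)) (j : Fin c) : Bool :=
  Fin.cases false (fun i => w k (e (Sum.inl (u, i, j)))) i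

/-- Bit `j` of the combination of symbols of message `k` for the pair `x` of users: the uncached
symbol of the pair, plus the symbols of the two cached parts that the query points at. Here
`q k u v` is the index, in the part of message `k` cached by `u`, that serves user `v`. -/
def pairSymbol (w : Library 2 L) (q : Fin 2 → Fin Ku → Fin Ku → Fin (m + 1)) (k : Fin 2)
    (x : UserPair Ku) (j : Fin c) : Bool :=
  w k (e (Sum.inr (Sum.inl (x, j)))) ^^
    (cachedSymbol e w k x.1.1 (q k x.1.1 x.1.2) j ^^ cachedSymbol e w k x.1.2 (q k x.1.2 x.1.1) j)

/-- The query to database `n`: the random index `p k u v` is shifted by `n` when `v` wants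
message `k`, and is the same at all databases otherwise. -/
def shiftedQuery (θ : Demand 2 Ku) (p : Fin 2 → Fin Ku → Fin Ku → Fin (m + 1)) (n : Fin (m + 1)) :
    Fin 2 → Fin Ku → Fin Ku → Fin (m + 1) :=
  fun k u v => p k u v + if θ v = k then n else 0

/-- The two-message scheme for `m + 1` databases. Database `0` sends the pair symbols of both
messages separately, and every other database sends their sums. -/
def twoMessageScheme : Scheme 2 Ku (m + 1) L where
  cached u := Finset.univ.image fun x : Fin 2 × Fin m × Fin c => (x.1, e (Sum.inl (u, x.2)))
  Query _ := Fin 2 → Fin Ku → Fin Ku → Fin (m + 1)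
  Answer n := AnswerPos Ku m c b n → Bool
  queryLaw θ := (PMF.uniformOfFintype (Fin 2 → Fin Ku → Fin Ku → Fin (m + 1))).map
    (shiftedQuery θ)
  answer n q w := Sum.elim
    (fun y => if n = 0 then pairSymbol e w q y.2.2 y.1 y.2.1
      else pairSymbol e w q 0 y.1 y.2.1 ^^ pairSymbol e w q 1 y.1 y.2.1)
    fun y => w y.1.1 (e (Sum.inr (Sum.inr y.1.2)))

theorem card_cached_twoMessageScheme_le (u : Fin Ku) :
    ((twoMessageScheme e).cached u).card ≤ 2 * (m * c) := by
  refine Finset.card_image_le.trans ?_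
  simp

theorem private_twoMessageScheme : (twoMessageScheme e).Private := by
  refine Scheme.private_of_map_queryLaw _
    (fun _ => PMF.uniformOfFintype (Fin 2 → Fin Ku → Fin Ku → Fin (m + 1))) fun θ n => ?_
  refine (PMF.map_comp _ _ _).trans ?_
  exact map_uniformOfFintype_of_bijective (Equiv.addRight
    (fun k _ v => if θ v = k then n else 0 : Fin 2 → Fin Ku → Fin Ku → Fin (m + 1))).bijective

theorem sum_entropy_twoMessageScheme_le (θ : Demand 2 Ku) :
    ∑ n, entropy ((twoMessageScheme e).law θ) ((twoMessageScheme e).ans n) ≤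
      Fintype.card (UserPair Ku) * (c * (m + 2)) + 2 * b := by
  refine (Scheme.sum_entropy_ans_le _ θ).trans ?_
  have h : ∀ n, Real.logb 2 (Fintype.card ((twoMessageScheme e).Answer n)) =
      Fintype.card (AnswerPos Ku m c b n) := fun n => by
    have : Fintype.card ((twoMessageScheme e).Answer n) =
        2 ^ Fintype.card (AnswerPos Ku m c b n) := by
      refine (Fintype.card_congr (Equiv.refl (AnswerPos Ku m c b n → Bool))).trans ?_
      rw [Fintype.card_fun, Fintype.card_bool]
    rw [this, Nat.cast_pow, Nat.cast_ofNat, Real.logb_pow, Real.logb_self_eq_one (by norm_num),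
      mul_one]
  have h0 : Fintype.card (AnswerPos Ku m c b 0) =
      Fintype.card (UserPair Ku) * (c * 2) + 2 * b := by
    simp [Fintype.card_subtype]
  have h1 : ∀ n : Fin m, Fintype.card (AnswerPos Ku m c b n.succ) =
      Fintype.card (UserPair Ku) * c := fun n => by
    simp [Fintype.card_subtype]
  simp only [h, Fin.sum_univ_succ, h0, h1]
  simp
  ring_nf
  rfl

/-- Two libraries with the same pair symbol also agree in the uncached symbol of the pair, if they
agree in the two cached symbols that occur. -/
theorem uncached_eq_of_pairSymbol_eq {w w' : Library 2 L}
    {q : Fin 2 → Fin Ku → Fin Ku → Fin (m + 1)} {k : Fin 2} {x : UserPair Ku} {j : Fin c}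
    (h : pairSymbol e w q k x j = pairSymbol e w' q k x j)
    (h1 : cachedSymbol e w k x.1.1 (q k x.1.1 x.1.2) j =
      cachedSymbol e w' k x.1.1 (q k x.1.1 x.1.2) j)
    (h2 : cachedSymbol e w k x.1.2 (q k x.1.2 x.1.1) j =
      cachedSymbol e w' k x.1.2 (q k x.1.2 x.1.1) j) :
    w k (e (Sum.inr (Sum.inl (x, j)))) = w' k (e (Sum.inr (Sum.inl (x, j)))) := by
  rw [pairSymbol, pairSymbol, h1, h2] at h
  exact Bool.xor_left_inj.1 h

theorem cachedSymbol_zero (w : Library 2 L) (k : Fin 2) (u : Fin Ku) (j : Fin c) :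
    cachedSymbol e w k u 0 j = false := rfl

theorem xor_congr_middle : ∀ a a' r s t t' : Bool,
    (a ^^ (r ^^ t)) = (a' ^^ (r ^^ t')) → (a ^^ (s ^^ t)) = (a' ^^ (s ^^ t')) := by
  decide

theorem xor_congr_right : ∀ a a' r s t t' : Bool,
    (a ^^ (t ^^ r)) = (a' ^^ (t' ^^ r)) → (a ^^ (t ^^ s)) = (a' ^^ (t' ^^ s)) := by
  decide

theorem middle_eq_of_xor_eq_xor : ∀ a a' r t t' : Bool,
    a = a' → (a ^^ (t ^^ r)) = (a' ^^ (t' ^^ r)) → t = t' := by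
  decide

theorem right_eq_of_xor_eq_xor : ∀ a a' r t t' : Bool,
    a = a' → (a ^^ (r ^^ t)) = (a' ^^ (r ^^ t')) → t = t' := by
  decide

theorem decodable_twoMessageScheme : (twoMessageScheme e).Decodable := by
  rw [Scheme.decodable_iff]
  intro θ u q hq w w' hA hZ
  obtain ⟨p, -, rfl⟩ : ∃ p ∈ (PMF.uniformOfFintype _).support, shiftedQuery θ p = q :=
    PMF.mem_support_map_iff _ _ _ |>.1 hq
  obtain ⟨k', hk'⟩ : ∃ k' : Fin 2, θ u ≠ k' := (exists_ne (θ u)).imp fun _ => Ne.symm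
  have hcache : ∀ k i j, cachedSymbol e w k u i j = cachedSymbol e w' k u i j := fun k i j => by
    refine Fin.cases rfl (fun i => ?_) i
    exact hZ (k, e (Sum.inl (u, i, j)))
      (Finset.mem_image.2 ⟨(k, i, j), Finset.mem_univ _, rfl⟩)
  -- database `0` reveals the combinations of each message separately
  have hzero : ∀ k x j, pairSymbol e w (shiftedQuery θ p 0) k x j =
      pairSymbol e w' (shiftedQuery θ p 0) k x j := fun k x j => by
    have := congrFun (hA 0) (Sum.inl (x, j, ⟨k, Or.inl rfl⟩))
    simpa [twoMessageScheme] using this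
  have hraw : ∀ k j, w k (e (Sum.inr (Sum.inr j))) = w' k (e (Sum.inr (Sum.inr j))) := fun k j =>
    congrFun (hA 0) (Sum.inr ⟨(k, j), rfl⟩)
  have hsum : ∀ n, n ≠ 0 → ∀ x j,
      (pairSymbol e w (shiftedQuery θ p n) 0 x j ^^ pairSymbol e w (shiftedQuery θ p n) 1 x j) =
      (pairSymbol e w' (shiftedQuery θ p n) 0 x j ^^
        pairSymbol e w' (shiftedQuery θ p n) 1 x j) := fun n hn x j => by
    have := congrFun (hA n) (Sum.inl (x, j, ⟨0, Or.inr rfl⟩))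
    simpa [twoMessageScheme, hn] using this
  -- for a pair with `u`, the combination of the unwanted message changes from one database to the
  -- next only in a symbol cached by `u`, so it is known at all databases
  have hother : ∀ n (x : UserPair Ku), (x.1.1 = u ∨ x.1.2 = u) → ∀ j,
      pairSymbol e w (shiftedQuery θ p n) k' x j =
        pairSymbol e w' (shiftedQuery θ p n) k' x j := by
    intro n x hx j
    have h0 := hzero k' x j
    obtain ⟨⟨v, v'⟩, hvv⟩ := x
    simp only [pairSymbol, shiftedQuery] at h0 hx ⊢
    rcases hx with rfl | rfl
    · simp only [if_neg hk', hcache] at h0 ⊢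
      exact xor_congr_middle _ _ _ _ _ _ h0
    · simp only [if_neg hk', hcache] at h0 ⊢
      exact xor_congr_right _ _ _ _ _ _ h0
  -- hence so is the combination of the wanted message
  have hwanted : ∀ n (x : UserPair Ku), (x.1.1 = u ∨ x.1.2 = u) → ∀ j,
      pairSymbol e w (shiftedQuery θ p n) (θ u) x j =
        pairSymbol e w' (shiftedQuery θ p n) (θ u) x j := by
    intro n x hx j
    by_cases hn : n = 0
    · subst hn
      exact hzero _ x j
    have h := hsum n hn x j
    have h' := hother n x hx j
    obtain ⟨h0, h1⟩ | ⟨h0, h1⟩ : θ u = 0 ∧ k' = 1 ∨ θ u = 1 ∧ k' = 0 := by omega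
    · rw [h1] at h'
      rw [h', Bool.xor_left_inj] at h
      rw [h0, h]
    · rw [h1] at h'
      rw [h', Bool.xor_right_inj] at h
      rw [h0, h]
  -- the shifted index runs through all symbols of the part of the other user `v`, and through the
  -- dummy symbol, which isolates the uncached symbol
  have hpart : ∀ v i j, cachedSymbol e w (θ u) v i j = cachedSymbol e w' (θ u) v i j := by
    intro v i j
    rcases lt_trichotomy u v with huv | rfl | huv
    · have H : ∀ n, _ := fun n => hwanted n ⟨(u, v), huv⟩ (Or.inl rfl) j
      simp only [pairSymbol, shiftedQuery, if_true, hcache] at H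
      have h0 := H (-p (θ u) v u)
      have hi := H (i - p (θ u) v u)
      simp only [add_neg_cancel, add_sub_cancel, cachedSymbol_zero] at h0 hi
      exact right_eq_of_xor_eq_xor _ _ _ _ _ (by simpa using h0) hi
    · exact hcache _ i j
    · have H : ∀ n, _ := fun n => hwanted n ⟨(v, u), huv⟩ (Or.inr rfl) j
      simp only [pairSymbol, shiftedQuery, if_true, hcache] at H
      have h0 := H (-p (θ u) v u)
      have hi := H (i - p (θ u) v u)
      simp only [add_neg_cancel, add_sub_cancel, cachedSymbol_zero] at h0 hi
      exact middle_eq_of_xor_eq_xor _ _ _ _ _ (by simpa using h0) hi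
  funext l
  obtain ⟨y, rfl⟩ := e.surjective l
  rcases y with ⟨v, i, j⟩ | ⟨x, j⟩ | j
  · exact hpart v i.succ j
  · exact uncached_eq_of_pairSymbol_eq e (hzero _ x j) (hpart ..) (hpart ..)
  · exact hraw _ j

end TwoMessageScheme

/-- Memory sharing between the two-message scheme and plain transmission: message length `y`, with
symbols of `x` bits. -/
theorem achievable_of_rat {Ku m x y : ℕ} (hy : 0 < y)
    (hxy : x * (Ku * m + Fintype.card (UserPair Ku)) ≤ y) :
    Achievable 2 Ku (m + 1) (2 * m * (x / y))
      (2 - (x / y) * (2 * Ku * m - Fintype.card (UserPair Ku) * m)) := by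
  obtain ⟨b, hb⟩ := Nat.exists_eq_add_of_le hxy
  have hcard : Fintype.card (BitPos Ku m x b) = y := by
    simp only [Fintype.card_sum, Fintype.card_prod, Fintype.card_fin]
    rw [hb]
    ring
  let e := Fintype.equivFinOfCardEq hcard
  have hy' : (0 : ℝ) < y := by exact_mod_cast hy
  refine ⟨y, twoMessageScheme e, hy, fun u => ?_, decodable_twoMessageScheme e,
    private_twoMessageScheme e, fun θ => ?_⟩
  · have : (_ : ℝ) ≤ _ := Nat.cast_le.2 (card_cached_twoMessageScheme_le e u)
    push_cast at this
    refine this.trans_eq ?_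
    field_simp
  · rw [Scheme.load, div_le_iff₀ hy']
    refine (sum_entropy_twoMessageScheme_le e θ).trans_eq ?_
    rw [sub_mul, div_mul_eq_mul_div, div_mul_cancel₀ _ hy'.ne']
    have : (y : ℝ) = _ := congrArg Nat.cast hb
    push_cast at this
    linear_combination (-2) * this

/-! ### The optimal load for two and three users -/

theorem memPt_one_eq {Ku : ℕ} (hKu : Ku = 2 ∨ Ku = 3) (N : ℕ) : memPt Ku N 1 =
    2 * ((N : ℝ) - 1) / ((Ku : ℝ) * ((N : ℝ) - 1) + (Ku : ℝ) * ((Ku : ℝ) - 1) / 2) := by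
  rcases hKu with rfl | rfl <;> norm_num [memPt, Nat.choose]

theorem memPt_one_pos {Ku N : ℕ} (hKu : Ku = 2 ∨ Ku = 3) (hN : 2 ≤ N) : 0 < memPt Ku N 1 := by
  have hN' : (2 : ℝ) ≤ N := by exact_mod_cast hN
  rw [memPt_one_eq hKu]
  rcases hKu with rfl | rfl <;> exact div_pos (by linarith) (by push_cast; linarith)

theorem loadPt_one_eq {Ku N : ℕ} (hKu : Ku = 2 ∨ Ku = 3) (hN : 2 ≤ N) :
    loadPt Ku N 1 = 2 - 3 / 2 * memPt Ku N 1 := by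
  have hN' : (2 : ℝ) ≤ N := by exact_mod_cast hN
  have hpos := memPt_one_pos hKu hN
  have key : ((Ku.choose 2 : ℝ) * ((N : ℝ) + 1) /
      ((Ku.choose 1 : ℝ) * ((N : ℝ) - 1) + (Ku.choose 2 : ℝ))) = 2 - 3 / 2 * memPt Ku N 1 := by
    rw [memPt_one_eq hKu]
    rcases hKu with rfl | rfl
    · have : (2 : ℝ) * (N - 1) + 1 ≠ 0 := by linarith
      norm_num [Nat.choose]
      field_simp
      ring
    · have h3 : (3 : ℝ) * (N - 1) + 3 = 3 * N := by ring
      have : (N : ℝ) ≠ 0 := by linarith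
      norm_num [Nat.choose, h3]
      field_simp
      ring
  rw [loadPt]
  refine (min_eq_left ?_).trans key
  rw [key]
  linarith

/-- For two and three users all corner points lie on or above the line `R = 2 - 3M/2`, which
passes through the first two of them. -/
theorem schemeLoad_eq {Ku N : ℕ} (hKu : Ku = 2 ∨ Ku = 3) (hN : 2 ≤ N) {M : ℝ} (h0 : 0 ≤ M)
    (h1 : M ≤ memPt Ku N 1) : schemeLoad Ku N M = 2 - 3 / 2 * M := by
  have hN' : (2 : ℝ) ≤ N := by exact_mod_cast hN
  have hpos := memPt_one_pos hKu hN
  refine IsLeast.csInf_eq ⟨?_, fun y hy => ?_⟩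
  · have hA : ((0, 2) : ℝ × ℝ) ∈ cornerPts Ku N := by simp [cornerPts]
    have hB : (memPt Ku N 1, loadPt Ku N 1) ∈ cornerPts Ku N :=
      Or.inr ⟨1, le_rfl, by omega, rfl⟩
    refine segment_subset_convexHull hA hB ⟨1 - M / memPt Ku N 1, M / memPt Ku N 1,
      sub_nonneg.2 ((div_le_one hpos).2 h1), by positivity, by ring, ?_⟩
    rw [loadPt_one_eq hKu hN]
    ext
    · simp [hpos.ne']
    · simp
      field_simp
      ring
  · have hconv : Convex ℝ {p : ℝ × ℝ | 2 ≤ (p.2 + 3 / 2 * p.1 : ℝ)} := by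
      intro p hp q hq a b ha hb hab
      simp only [Set.mem_ofPred_eq, Prod.fst_add, Prod.snd_add, Prod.smul_fst, Prod.smul_snd,
        smul_eq_mul] at hp hq ⊢
      nlinarith
    have hsub : cornerPts Ku N ⊆ {p : ℝ × ℝ | 2 ≤ (p.2 + 3 / 2 * p.1 : ℝ)} := by
      rintro p ((rfl | rfl) | ⟨t, ht1, ht2, rfl⟩)
      · norm_num
      · norm_num
      · obtain rfl | ⟨rfl, rfl⟩ : t = 1 ∨ t = 2 ∧ Ku = 3 := by omega
        · simp [loadPt_one_eq hKu hN]
        · have hd : (0 : ℝ) < 3 * (N - 1) + 1 := by linarith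
          have hm : memPt 3 N 2 = 4 * ((N : ℝ) - 1) / (3 * (N - 1) + 1) := by
            norm_num [memPt, Nat.choose]
          have hm0 : 0 ≤ memPt 3 N 2 := by
            rw [hm]
            exact div_nonneg (by linarith) hd.le
          have hl : 2 - 3 / 2 * memPt 3 N 2 ≤ loadPt 3 N 2 := by
            refine le_min ?_ (by linarith)
            rw [hm]
            norm_num [Nat.choose]
            rw [← sub_nonneg, show ((N : ℝ) + 1) / (3 * (N - 1) + 1) + 3 / 2 * (4 * (N - 1) /
              (3 * (N - 1) + 1)) - 2 = (N - 1) / (3 * (N - 1) + 1) by field_simp; ring]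
            exact div_nonneg (by linarith) hd.le
          simp only [Set.mem_ofPred_eq]
          linarith
    have := convexHull_min hsub hconv hy
    simp only [Set.mem_ofPred_eq] at this
    linarith

theorem Achievable.mono {K Ku N : ℕ} {M M' R : ℝ} (h : Achievable K Ku N M R) (hM : M ≤ M') :
    Achievable K Ku N M' R := by
  obtain ⟨L, s, hL, hc, hs⟩ := h
  exact ⟨L, s, hL, fun u => (hc u).trans (mul_le_mul_of_nonneg_right hM L.cast_nonneg), hs⟩

theorem achievable_rat {Ku N : ℕ} (hKu : Ku = 2 ∨ Ku = 3) (hN : 2 ≤ N) {M : ℚ}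
    (h0 : 0 ≤ M) (h1 : (M : ℝ) ≤ memPt Ku N 1) : Achievable 2 Ku N M (2 - 3 / 2 * M) := by
  obtain ⟨m, rfl⟩ : ∃ m, N = m + 1 := ⟨N - 1, by omega⟩
  have hm : (0 : ℝ) < m := by exact_mod_cast (show 0 < m by omega)
  have hcard : (Fintype.card (UserPair Ku) : ℝ) = Ku * (Ku - 1) / 2 ∧
      (2 * Ku - Fintype.card (UserPair Ku) : ℝ) = 3 := by
    rcases hKu with rfl | rfl
    · have : Fintype.card (UserPair 2) = 1 := by decide
      rw [this]
      norm_num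
    · have : Fintype.card (UserPair 3) = 3 := by decide
      rw [this]
      norm_num
  -- the number of bits per symbol, in proportion to the message length
  set r : ℚ := M / (2 * m) with hr
  have hrM : (M : ℝ) = 2 * m * (r.num.toNat / r.den) := by
    have hrn : (r.num.toNat : ℝ) = r.num := by
      exact_mod_cast Int.toNat_of_nonneg (Rat.num_nonneg.2 (by positivity))
    rw [hrn, ← Rat.cast_def, hr]
    push_cast
    field_simp
  have hden : (0 : ℝ) < r.den := by exact_mod_cast r.den_pos
  have hxy : r.num.toNat * (Ku * m + Fintype.card (UserPair Ku)) ≤ r.den := by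
    have hD : (0 : ℝ) < Ku * m + Fintype.card (UserPair Ku) := by
      have : (2 : ℝ) ≤ Ku := by exact_mod_cast (show 2 ≤ Ku by omega)
      positivity
    rw [memPt_one_eq hKu, ← hcard.1, Nat.cast_add_one, add_sub_cancel_right, hrM,
      ← mul_div_assoc, div_le_div_iff₀ hden hD, mul_assoc,
      mul_le_mul_iff_right₀ (by positivity)] at h1
    exact_mod_cast h1
  have := achievable_of_rat r.den_pos hxy
  rw [← hrM] at this
  convert this using 1
  rw [hrM]
  linear_combination (r.num.toNat / r.den * m : ℝ) * hcard.2

end MuPIR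

end

theorem corollary2 (Ku N : ℕ) (hKu : Ku = 2 ∨ Ku = 3) (hN : 2 ≤ N) :
    MuPIR.memPt Ku N 1 =
      2 * ((N : ℝ) - 1) / ((Ku : ℝ) * ((N : ℝ) - 1) + (Ku : ℝ) * ((Ku : ℝ) - 1) / 2) ∧
    ∀ M : ℝ, 0 ≤ M → M ≤ MuPIR.memPt Ku N 1 →
      IsGLB {R : ℝ | MuPIR.Achievable 2 Ku N M R} (MuPIR.schemeLoad Ku N M) ∧
      ((∃ q : ℚ, M = (q : ℝ)) →
        IsLeast {R : ℝ | MuPIR.Achievable 2 Ku N M R} (MuPIR.schemeLoad Ku N M)) := by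
  refine ⟨MuPIR.memPt_one_eq hKu N, fun M h0 h1 => ?_⟩
  rw [MuPIR.schemeLoad_eq hKu hN h0 h1]
  have hlow : 2 - 3 / 2 * M ∈ lowerBounds {R : ℝ | MuPIR.Achievable 2 Ku N M R} :=
    fun R hR => MuPIR.Achievable.le (by omega) hR
  have hrat : ∀ q : ℚ, M = q → IsLeast {R : ℝ | MuPIR.Achievable 2 Ku N M R} (2 - 3 / 2 * M) := by
    rintro q rfl
    exact ⟨MuPIR.achievable_rat hKu hN (by exact_mod_cast h0) h1, hlow⟩
  refine ⟨⟨hlow, fun R hR => le_of_forall_pos_le_add fun ε hε => ?_⟩, fun ⟨q, hq⟩ => hrat q hq⟩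
  rcases h0.eq_or_lt with rfl | hM
  · exact (hR (hrat 0 (by simp)).1).trans (by linarith)
  -- approximate the memory from below by a rational number
  · obtain ⟨q, hq, hqM⟩ := exists_rat_btwn (max_lt hM (sub_lt_self M (half_pos hε)))
    have hq0 : (0 : ℝ) < q := (le_max_left _ _).trans_lt hq
    have hqε : M - ε / 2 < q := (le_max_right _ _).trans_lt hq
    have hach := (MuPIR.achievable_rat hKu hN (by exact_mod_cast hq0.le)
      (hqM.le.trans h1)).mono hqM.le
    exact (hR hach).trans (by linarith)
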